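/- Let $X$ be a topological space with a $\sigma$-algebra containing the open sets, let $k:X\times X\to\mathbb R$ be a (symmetric) positive definite, jointly continuous kernel with reproducing kernel Hilbert space $\mathcal H_k$, and let $\nu$ be a finite measure on $X$ with $\int k(u,u)\,\nu(du)<\infty$ (which is automatic if $k$ is bounded). Put $$r(x,x')=\int k(x,u)\,k(u,x')\,\nu(du),\qquad x,x'\in X.$$ 1. There is a bounded operator $S_k:L^2(X;\nu)\to\mathcal H_k$ with $[S_kf](x)=\int f(u)\,k(x,u)\,\nu(du)$ for all $f\in L^2(X;\nu)$ and $x\in X$; its adjoint $S_k^*$ is the inclusion of $\mathcal H_k$ into $L^2(X;\nu)$. The operator $L=S_kS_k^*:\mathcal H_k\to\mathcal H_k$ is positive, self-adjoint and of trace class, and $r(x,x')=\langle S_kS_k^*k(\cdot,x),k(\cdot,x')\rangle_{\mathcal H_k}$ for all $x,x'\in X$. All the integrals here converge absolutely. 2. $r$ is a positive definite kernel, and $k$ nuclearly dominates $r$: $\mathcal H_r\subseteq\mathcal H_k$, and $r(x,x')=\langle L'k(\cdot,x),k(\cdot,x')\rangle_{\mathcal H_k}$ for some positive, continuous, self-adjoint,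 trace-class operator $L'$ on $\mathcal H_k$. 3. $\mathcal{GP}(0,r)$ is a valid prior on $\mathcal H_k$: there is a Gaussian Borel probability measure on $\mathcal H_k$ under which the process of evaluations $x\mapsto h(x)$, $h\in\mathcal H_k$, is a centred Gaussian process with covariance function $r$. 4. $\mathcal{GP}(0,r)$ has sample paths in $\mathcal H_k$ almost surely: every centred Gaussian process $(Y_x)_{x\in X}$ with covariance function $r$, on any probability space, has a modification that is given by a strongly measurable $\mathcal H_k$-valued random element $F$, that is, for each $x\in X$, $Y_x=F(x)$ almost surely. If moreover $X$ is separable and $Y$ has almost surely continuous sample paths, then almost every sample path of $Y$ itself belongs to $\mathcal H_k$. -/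

import Mathlib

open MeasureTheory ProbabilityTheory
open scoped InnerProductSpace

universe u w

namespace KernelPrior

noncomputable section

/-- A (symmetric) positive definite kernel on `X`: `k x y = k y x` and
`∑ i, ∑ j, c i * k (x i) (x j) * c j ≥ 0` for all finite families. -/
def IsKernel {X : Type u} (k : X → X → ℝ) : Prop :=
  (Matrix.of k).PosSemidef

/-- The kernel `k`, read as a matrix of operators on the one-dimensional space `ℝ`. -/
def opKernel {X : Type u} (k : X → X → ℝ) : Matrix X X (ℝ →L[ℝ] ℝ) :=
  Matrix.of fun x y => k x y • ContinuousLinearMap.id ℝ ℝ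

theorem IsKernel.posSemidef_opKernel {X : Type u} {k : X → X → ℝ} (hk : IsKernel k) :
    (opKernel k).PosSemidef := by
  have hs : ∀ x y, k y x = k x y := fun x y => by simpa using hk.1.apply x y
  have hpos : (opKernel k).IsHermitian ∧ ∀ (vv : X →₀ ℝ),
      0 ≤ RCLike.re (vv.sum fun x w => vv.sum fun x' w' => ⟪opKernel k x' x w, w'⟫_ℝ) := by
    refine ⟨?_, fun c => ?_⟩
    · ext x y
      simp [opKernel, hs x y, ContinuousLinearMap.star_eq_adjoint, ContinuousLinearMap.adjoint_id]
    · have h := hk.2 c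
      simp only [Matrix.of_apply, star_trivial] at h
      have he : ∀ (w w' : ℝ) (y y' : X),
          ⟪opKernel k y' y w, w'⟫_ℝ = w * k y y' * w' := fun w w' y y' => by
        simp [opKernel, hs y y']
        ring
      simpa only [he, RCLike.re_to_real] using h
  exact (RKHS.posSemidef_tfae.out 0 2).mpr hpos

/-- The reproducing kernel Hilbert space `H_k` of the kernel `k`. -/
def KernelRKHS {X : Type u} (k : X → X → ℝ) (hk : IsKernel k) : Type u :=
  haveI : Fact (opKernel k).PosSemidef := ⟨hk.posSemidef_opKernel⟩
  RKHS.OfKernel (opKernel k)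

section Instances

variable {X : Type u} {k : X → X → ℝ} (hk : IsKernel k)

instance : NormedAddCommGroup (KernelRKHS k hk) :=
  haveI : Fact (opKernel k).PosSemidef := ⟨hk.posSemidef_opKernel⟩
  inferInstanceAs (NormedAddCommGroup (RKHS.OfKernel (opKernel k)))

instance : InnerProductSpace ℝ (KernelRKHS k hk) :=
  haveI : Fact (opKernel k).PosSemidef := ⟨hk.posSemidef_opKernel⟩
  inferInstanceAs (InnerProductSpace ℝ (RKHS.OfKernel (opKernel k)))

instance : CompleteSpace (KernelRKHS k hk) :=
  haveI : Fact (opKernel k).PosSemidef := ⟨hk.posSemidef_opKernel⟩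
  inferInstanceAs (CompleteSpace (RKHS.OfKernel (opKernel k)))

/-- Elements of `H_k` are functions `X → ℝ`, with continuous point evaluations. -/
instance : RKHS ℝ (KernelRKHS k hk) X ℝ :=
  haveI : Fact (opKernel k).PosSemidef := ⟨hk.posSemidef_opKernel⟩
  inferInstanceAs (RKHS ℝ (RKHS.OfKernel (opKernel k)) X ℝ)

instance : MeasurableSpace (KernelRKHS k hk) := borel _

instance : BorelSpace (KernelRKHS k hk) := ⟨rfl⟩

end Instances

/-- The function `k(·, x)`, as an element of `H_k`. -/
def feature {X : Type u} {k : X → X → ℝ} (hk : IsKernel k) (x : X) : KernelRKHS k hk :=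
  RKHS.kerFun (KernelRKHS k hk) x 1

theorem kernel_kernelRKHS {X : Type u} {k : X → X → ℝ} (hk : IsKernel k) :
    RKHS.kernel (KernelRKHS k hk) = opKernel k :=
  haveI : Fact (opKernel k).PosSemidef := ⟨hk.posSemidef_opKernel⟩
  RKHS.OfKernel.kernel_ofKernel (K := opKernel k)

/-- `feature hk x` is the function `k(·, x)`. -/
theorem feature_apply {X : Type u} {k : X → X → ℝ} (hk : IsKernel k) (x y : X) :
    feature hk x y = k y x := by
  rw [feature, RKHS.kerFun_apply, kernel_kernelRKHS]
  simp [opKernel]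

/-- The reproducing property `h(x) = ⟨h, k(·, x)⟩`. -/
theorem inner_feature {X : Type u} {k : X → X → ℝ} (hk : IsKernel k)
    (h : KernelRKHS k hk) (x : X) : ⟪h, feature hk x⟫_ℝ = h x := by
  simp [feature]

/-- A bounded operator `T` on a real Hilbert space is of trace class if its modulus `|T|`, the
positive square root of `T† T`, has finite trace: `∑ i, ⟨|T| b i, b i⟩ < ∞` in every
orthonormal (Hilbert) basis `b`. -/
def IsTraceClass {H : Type u} [NormedAddCommGroup H] [InnerProductSpace ℝ H] [CompleteSpace H]
    (T : H →L[ℝ] H) : Prop :=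
  ∃ A : H →L[ℝ] H, A.IsPositive ∧ A ∘L A = ContinuousLinearMap.adjoint T ∘L T ∧
    ∀ (ι : Type u) (b : HilbertBasis ι ℝ H), Summable fun i => ⟪A (b i), b i⟫_ℝ

/-- `k` dominates `r`: every function in `H_r` belongs to `H_k`. -/
def Dominates {X : Type u} {k r : X → X → ℝ} (hk : IsKernel k) (hr : IsKernel r) : Prop :=
  ∀ f : KernelRKHS r hr, ∃ g : KernelRKHS k hk, ∀ x, g x = f x

/-- `k` nuclearly dominates `r`: `k` dominates `r`, and `r(x, x') = ⟨L k(·, x), k(·, x')⟩` for a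
positive, continuous, self-adjoint, trace-class operator `L` on `H_k`. -/
def NuclearlyDominates {X : Type u} {k r : X → X → ℝ} (hk : IsKernel k) (hr : IsKernel r) :
    Prop :=
  Dominates hk hr ∧
    ∃ L : KernelRKHS k hk →L[ℝ] KernelRKHS k hk,
      L.IsPositive ∧ IsSelfAdjoint L ∧ IsTraceClass L ∧
        ∀ x x', r x x' = ⟪L (feature hk x), feature hk x'⟫_ℝ

/-- `r(x, x') = ∫ k(x, u) k(u, x') ν(du)`. -/
def convKernel {X : Type u} [MeasurableSpace X] (k : X → X → ℝ) (ν : Measure X) (x x' : X) : ℝ :=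
  ∫ v, k x v * k v x' ∂ν

/-- The process `(Y x)` is a version of `GP(0, r)`: a Gaussian process with mean zero and
covariance function `r`. -/
structure IsGP {X : Type u} {Ω : Type w} [MeasurableSpace Ω] (r : X → X → ℝ) (Y : X → Ω → ℝ)
    (P : Measure Ω) : Prop where
  isGaussianProcess : IsGaussianProcess Y P
  mean_eq_zero : ∀ x, ∫ ω, Y x ω ∂P = 0
  cov_eq : ∀ x x', cov[Y x, Y x'; P] = r x x'

end

end KernelPrior

/-! Everything rests on the inclusion `J : H_k → L²(ν)`. It is bounded since `h(v)² ≤ ‖h‖² k(v,v)`,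
and Hilbert–Schmidt since Bessel's inequality gives `∑ ‖J bᵢ‖² ≤ ∫ k(v,v) dν`
(`summable_norm_inclusion_lp_sq`). With `S = J†`, the operator `S S† = J† J` is trace class, and
`r(x,x') = ⟨J k(·,x), J k(·,x')⟩` is a Gram matrix. Hence `r` is a kernel and `H_r` embeds
isometrically in `L²(ν)`, from where `J†` leads into `H_k`.

For the probabilistic claims, a Hilbert–Schmidt operator `V : H_k → L²(P)` has the form `V h = ⟨F,
h⟩` with `F` a random element of `H_k` (`exists_lp_inner_eq`). Taking `V = W J`, with `W` isonormal
on `L²(ν)`, makes the law of `F` the Gaussian prior. Taking `V k(·,x) = Y x`, which extends from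
features because the Gram matrices agree (`exists_clm_of_inner_eq`), makes `F` a modification of
`Y`. -/

namespace KernelPrior

/-! ### Operators determined by Gram matrices -/

section Extension

variable {X H K G : Type*}
  [NormedAddCommGroup H] [InnerProductSpace ℝ H]
  [NormedAddCommGroup K] [InnerProductSpace ℝ K] [CompleteSpace K]
  [NormedAddCommGroup G] [InnerProductSpace ℝ G]

omit [CompleteSpace K] in
theorem norm_linearCombination_eq_of_inner_eq {z : X → K} {y : X → G}
    (h : ∀ x x', ⟪z x, z x'⟫_ℝ = ⟪y x, y x'⟫_ℝ) (c : X →₀ ℝ) :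
    ‖Finsupp.linearCombination ℝ z c‖ = ‖Finsupp.linearCombination ℝ y c‖ := by
  rw [← sq_eq_sq₀ (norm_nonneg _) (norm_nonneg _), ← real_inner_self_eq_norm_sq,
    ← real_inner_self_eq_norm_sq]
  simp only [Finsupp.linearCombination_apply, Finsupp.sum, sum_inner, inner_sum, inner_smul_left,
    inner_smul_right, h]

/-- Two families with the same Gram matrix correspond to each other under an operator. -/
theorem exists_clm_of_inner_eq {a : X → H} (ha : Dense (Submodule.span ℝ (Set.range a) : Set H))
    (T : H →L[ℝ] G) {z : X → K} (h : ∀ x x', ⟪z x, z x'⟫_ℝ = ⟪T (a x), T (a x')⟫_ℝ) :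
    ∃ V : H →L[ℝ] K, (∀ x, V (a x) = z x) ∧ ∀ v, ‖V v‖ = ‖T v‖ := by
  have hd : DenseRange (Finsupp.linearCombination ℝ a) := by
    rw [DenseRange, ← LinearMap.coe_range, Finsupp.range_linearCombination]
    exact ha
  have hn : ∀ c, ‖Finsupp.linearCombination ℝ z c‖ = ‖T (Finsupp.linearCombination ℝ a c)‖ := by
    intro c
    rw [norm_linearCombination_eq_of_inner_eq h c]
    congr 1
    simp [Finsupp.linearCombination_apply, Finsupp.sum]
  -- This bound also makes `∑ c a ↦ ∑ c z` well defined on the span of `a`.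
  have hb : ∃ C, ∀ c, ‖Finsupp.linearCombination ℝ z c‖
      ≤ C * ‖Finsupp.linearCombination ℝ a c‖ :=
    ⟨‖T‖, fun c => (hn c).trans_le (T.le_opNorm _)⟩
  refine ⟨(Finsupp.linearCombination ℝ z).extendOfNorm (Finsupp.linearCombination ℝ a),
    fun x => ?_, fun v => ?_⟩
  · have := LinearMap.extendOfNorm_eq hd hb (Finsupp.single x 1)
    simpa using this
  · refine hd.induction_on (p := fun v => ‖LinearMap.extendOfNorm _ _ v‖ = ‖T v‖) v
      (isClosed_eq (by fun_prop) (by fun_prop)) fun c => ?_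
    rw [LinearMap.extendOfNorm_eq hd hb, hn]

end Extension

/-! ### Hilbert–Schmidt operators into `L²(P)` as random elements -/

section HilbertSchmidt

variable {Ω ι H : Type*} [MeasurableSpace Ω] {P : Measure Ω}
  [NormedAddCommGroup H] [InnerProductSpace ℝ H] [CompleteSpace H]

/-- A Hilbert–Schmidt operator `V` into `L²(P)` is represented by a square integrable random
element `F`, in the sense that `V h = ⟨F, h⟩`. -/
theorem exists_lp_inner_eq (V : H →L[ℝ] Lp ℝ 2 P) (b : HilbertBasis ι ℝ H)
    (hV : Summable fun i => ‖V (b i)‖ ^ 2) :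
    ∃ F : Lp H 2 P, ∀ h, ∀ᵐ ω ∂P, V h ω = ⟪F ω, h⟫_ℝ := by
  -- The isometries `f ↦ f ⊗ bᵢ` have orthogonal ranges, so `F = ∑ V(bᵢ) ⊗ bᵢ` converges exactly
  -- when `∑ ‖V bᵢ‖²` does.
  let e : ι → Lp ℝ 2 P →ₗᵢ[ℝ] Lp H 2 P := fun i =>
    { toLinearMap := ((ContinuousLinearMap.toSpanSingleton ℝ (b i)).compLpL 2 P).toLinearMap
      norm_map' := fun f => by
        refine le_antisymm (Lp.norm_le_norm_of_ae_le ?_) (Lp.norm_le_norm_of_ae_le ?_) <;>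
        · filter_upwards [ContinuousLinearMap.coeFn_compLpL
            (ContinuousLinearMap.toSpanSingleton ℝ (b i)) f] with ω hω
          simp [hω, norm_smul, b.orthonormal.1 i] }
  have he : ∀ i f, e i f = (ContinuousLinearMap.toSpanSingleton ℝ (b i)).compLpL 2 P f :=
    fun i f => rfl
  have hae : ∀ i f, ∀ᵐ ω ∂P, e i f ω = f ω • b i := fun i f => by
    rw [he]
    filter_upwards [ContinuousLinearMap.coeFn_compLpL
      (ContinuousLinearMap.toSpanSingleton ℝ (b i)) f] with ω hω
    rw [hω]; simp
  have ho : OrthogonalFamily ℝ (fun _ : ι => Lp ℝ 2 P) e := by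
    intro i j hij f g
    rw [L2.inner_def]
    rw [integral_congr_ae (g := fun _ => (0 : ℝ)) ?_, integral_zero]
    filter_upwards [hae i f, hae j g] with ω h1 h2
    rw [h1, h2, inner_smul_left, inner_smul_right, b.orthonormal.2 hij]
    simp
  have hs : Summable fun i => e i (V (b i)) := (ho.summable_iff_norm_sq_summable _).2 hV
  refine ⟨∑' i, e i (V (b i)), fun h => ?_⟩
  let A := (innerSL ℝ h).compLpL 2 P
  have h1 : HasSum (fun i => ⟪b i, h⟫_ℝ • V (b i)) (A (∑' i, e i (V (b i)))) := by
    have := hs.hasSum.mapL A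
    convert this using 2 with i
    refine Lp.ext ?_
    filter_upwards [hae i (V (b i)), Lp.coeFn_smul (⟪b i, h⟫_ℝ) (V (b i)),
      ContinuousLinearMap.coeFn_compLpL (innerSL ℝ h) (e i (V (b i)))] with ω h1 h2 h3
    rw [h2, h3, h1]
    simp [real_inner_comm, mul_comm]
  have h2 : HasSum (fun i => ⟪b i, h⟫_ℝ • V (b i)) (V h) := by
    have := (b.hasSum_repr h).mapL V
    simpa [b.repr_apply_apply] using this
  rw [h2.unique h1]
  filter_upwards [ContinuousLinearMap.coeFn_compLpL (innerSL ℝ h) (∑' i, e i (V (b i)))]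
    with ω hω
  rw [hω]
  simp [real_inner_comm]

end HilbertSchmidt

/-! ### Gaussian laws in `L²(P)` and the isonormal process -/

section Gaussian

variable {Ω : Type*} [MeasurableSpace Ω] {P : Measure Ω} [IsProbabilityMeasure P]

/-- The function `x ↦ exp(itx) - 1` is Lipschitz and vanishes at `0`, so composition with it is
continuous on `L²`; the characteristic function is `1` plus the integral of the result. -/
theorem continuous_charFun_map_lp (t : ℝ) :
    Continuous fun f : Lp ℝ 2 P => charFun (P.map f) t := by
  let g : ℝ → ℂ := fun x => Complex.exp (t * x * Complex.I) - 1
  have hg : LipschitzWith ‖t‖₊ g := by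
    refine LipschitzWith.of_dist_le_mul fun x y => ?_
    have : g x - g y = Complex.exp (t * y * Complex.I) *
        (Complex.exp (Complex.I * (t * (x - y) : ℝ)) - 1) := by
      simp only [g, mul_sub, ← Complex.exp_add]
      push_cast
      ring_nf
    rw [dist_eq_norm, this, norm_mul, ← Complex.ofReal_mul, Complex.norm_exp_ofReal_mul_I, one_mul]
    refine Real.norm_exp_I_mul_ofReal_sub_one_le.trans_eq ?_
    simp [dist_eq_norm]
  have hg0 : g 0 = 0 := by simp [g]
  have key : ∀ f : Lp ℝ 2 P, charFun (P.map f) t =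
      ⟪indicatorConstLp 2 .univ (measure_ne_top P _) (1 : ℂ), hg.compLp hg0 f⟫_ℂ + 1 := by
    intro f
    rw [L2.inner_indicatorConstLp_one, setIntegral_univ,
      integral_congr_ae (hg.coeFn_compLp hg0 f), charFun_apply_real,
      integral_map (Lp.aestronglyMeasurable f).aemeasurable (by fun_prop)]
    have hi : Integrable (fun ω => Complex.exp (t * f ω * Complex.I)) P := by
      refine Integrable.of_bound (C := 1) ?_ (.of_forall fun ω => ?_)
      · have := Lp.aestronglyMeasurable f
        fun_prop
      · rw [← Complex.ofReal_mul, Complex.norm_exp_ofReal_mul_I]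
    simp only [g, Function.comp_def]
    rw [integral_sub hi (integrable_const _)]
    simp
  simp only [key]
  have := hg.continuous_compLp (p := 2) (μ := P) hg0
  fun_prop

/-- Characteristic functions determine laws, and on both sides they depend continuously on `f`. This
carries Gaussianity from finite sums to `L²` limits. -/
theorem isClosed_setOf_map_eq_gaussianReal :
    IsClosed {f : Lp ℝ 2 P | P.map (f : Ω → ℝ) = gaussianReal 0 (‖f‖₊ ^ 2)} := by
  have : {f : Lp ℝ 2 P | P.map (f : Ω → ℝ) = gaussianReal 0 (‖f‖₊ ^ 2)}
      = ⋂ t : ℝ, {f : Lp ℝ 2 P | charFun (P.map f) t = charFun (gaussianReal 0 (‖f‖₊ ^ 2)) t} := by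
    ext f
    have : IsProbabilityMeasure (P.map f) :=
      Measure.isProbabilityMeasure_map (Lp.aestronglyMeasurable f).aemeasurable
    simp only [Set.mem_ofPred_eq, Set.mem_iInter]
    exact ⟨fun h t => by rw [h], fun h => Measure.ext_of_charFun (funext h)⟩
  rw [this]
  refine isClosed_iInter fun t => isClosed_eq (continuous_charFun_map_lp t) ?_
  simp only [charFun_gaussianReal]
  push_cast
  fun_prop

omit [IsProbabilityMeasure P] in
theorem map_eq_gaussianReal_of_hasGaussianLaw {f : Lp ℝ 2 P} (hf : HasGaussianLaw f P)
    (h0 : ∫ ω, f ω ∂P = 0) : P.map (f : Ω → ℝ) = gaussianReal 0 (‖f‖₊ ^ 2) := by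
  rw [hf.map_eq_gaussianReal, h0]
  congr 1
  rw [variance_of_integral_eq_zero (Lp.aestronglyMeasurable f).aemeasurable h0]
  have : ∫ ω, f ω ^ 2 ∂P = ‖f‖ ^ 2 := by
    rw [← real_inner_self_eq_norm_sq, L2.inner_def]
    simp [sq]
  rw [this]
  ext
  simp

/-- The isonormal Gaussian process of a Hilbert space. -/
theorem exists_isonormal (G : Type u) [NormedAddCommGroup G] [InnerProductSpace ℝ G]
    [CompleteSpace G] :
    ∃ (Ω : Type u) (_ : MeasurableSpace Ω) (P : Measure Ω) (_ : IsProbabilityMeasure P)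
      (W : G →ₗᵢ[ℝ] Lp ℝ 2 P), ∀ g, P.map (W g) = gaussianReal 0 (‖g‖₊ ^ 2) := by
  obtain ⟨s, b, -⟩ := exists_hilbertBasis ℝ G
  obtain ⟨Ω, mΩ, P, ξ, hm, hlaw, hind, hP⟩ := exists_iid s (gaussianReal 0 1)
  have hg : ∀ i, HasGaussianLaw (ξ i) P := fun i => (hlaw i).hasGaussianLaw
  have hmem : ∀ i, MemLp (ξ i) 2 P := fun i => (hg i).memLp_two
  have hint0 : ∀ i, ∫ ω, ξ i ω ∂P = 0 := fun i => by
    rw [(hlaw i).integral_eq]; simp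
  let x : s → Lp ℝ 2 P := fun i => (hmem i).toLp
  have hx : ∀ i, x i =ᵐ[P] ξ i := fun i => (hmem i).coeFn_toLp
  have hon : Orthonormal ℝ x := by
    have hin : ∀ i j, ⟪x i, x j⟫_ℝ = cov[ξ i, ξ j; P] := fun i j => by
      rw [L2.inner_def, covariance_eq_sub (hmem i) (hmem j), hint0, zero_mul, sub_zero]
      refine integral_congr_ae ?_
      filter_upwards [hx i, hx j] with ω h1 h2
      simp [h1, h2, mul_comm]
    refine ⟨fun i => ?_, fun i j hij => ?_⟩
    · rw [← sq_eq_sq₀ (norm_nonneg _) zero_le_one, ← real_inner_self_eq_norm_sq, hin,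
        covariance_self (hm i).aemeasurable, (hlaw i).variance_eq]
      simp
    · refine (hin i j).trans ?_
      exact (hind.indepFun hij).covariance_eq_zero (hmem i) (hmem j)
  let W : G →ₗᵢ[ℝ] Lp ℝ 2 P :=
    hon.orthogonalFamily.linearIsometry.comp b.repr.toLinearIsometry
  refine ⟨Ω, mΩ, P, hP, W, fun g => ?_⟩
  obtain ⟨c, hW⟩ : ∃ c : s → ℝ, HasSum (fun i => c i • x i) (W g) :=
    ⟨_, hon.orthogonalFamily.hasSum_linearIsometry (b.repr g)⟩
  have hmemW : W g ∈ {f : Lp ℝ 2 P | P.map (f : Ω → ℝ) = gaussianReal 0 (‖f‖₊ ^ 2)} := by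
    refine isClosed_setOf_map_eq_gaussianReal.mem_of_tendsto hW (.of_forall fun t => ?_)
    have hae : (∑ i ∈ t, c i • x i : Lp ℝ 2 P) =ᵐ[P]
        fun ω => ∑ i : t, c i * ξ i ω := by
      have h1 : ∀ᵐ ω ∂P, ∀ i : t, (c i • x i : Lp ℝ 2 P) ω = c i * ξ i ω :=
        ae_all_iff.2 fun i => by
          filter_upwards [hx i, Lp.coeFn_smul (c i.1) (x i.1)] with ω h1 h2
          simp [h1, h2]
      filter_upwards [h1, Lp.coeFn_finsetSum t fun i => c i • x i] with ω h1 h2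
      rw [h2, Finset.sum_apply, ← Finset.sum_coe_sort]
      exact Finset.sum_congr rfl fun i _ => h1 i
    refine map_eq_gaussianReal_of_hasGaussianLaw (HasGaussianLaw.congr ?_ hae.symm) ?_
    · exact iIndepFun.hasGaussianLaw_fun_sum (fun i => (hg i).fun_smul (c i))
        ((hind.precomp Subtype.val_injective).comp (fun (i : t) y => c i * y)
          fun i => by fun_prop)
    · rw [integral_congr_ae hae, integral_finsetSum _ fun (i : t) _ => (hg i).integrable.const_mul _]
      simp [integral_const_mul, hint0]
  simpa using hmemW

end Gaussian

/-! ### Features and the reproducing property -/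

section Feature

variable {X : Type u} {k : X → X → ℝ} (hk : IsKernel k)

theorem inner_feature_feature (x y : X) : ⟪feature hk x, feature hk y⟫_ℝ = k y x := by
  rw [inner_feature, feature_apply]

theorem norm_feature_sq (x : X) : ‖feature hk x‖ ^ 2 = k x x := by
  rw [← real_inner_self_eq_norm_sq, inner_feature_feature]

/-- A function orthogonal to all features vanishes at every point, by the reproducing property. -/
theorem dense_span_range_feature :
    Dense (Submodule.span ℝ (Set.range (feature hk)) : Set (KernelRKHS k hk)) := by
  rw [Submodule.dense_iff_topologicalClosure_eq_top, Submodule.topologicalClosure_eq_top_iff,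
    Submodule.eq_bot_iff]
  intro h hh
  refine RKHS.ext (𝕜 := ℝ) fun x => ?_
  rw [← inner_feature, RKHS.coe_zero, real_inner_comm]
  exact hh _ (Submodule.subset_span (Set.mem_range_self x))

theorem continuous_feature [TopologicalSpace X] (hcont : Continuous fun p : X × X => k p.1 p.2) :
    Continuous (feature hk) := by
  refine continuous_iff_continuousAt.2 fun x => tendsto_iff_norm_sub_tendsto_zero.2 ?_
  have h1 : ∀ y, ‖feature hk y - feature hk x‖ = √(k y y - 2 * k x y + k x x) := fun y => by
    rw [← norm_feature_sq hk, ← norm_feature_sq hk, ← inner_feature_feature hk y x,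
      ← norm_sub_sq_real, Real.sqrt_sq (norm_nonneg _)]
  simp only [h1]
  have h2 : Continuous fun y => √(k y y - 2 * k x y + k x x) := by
    have := hcont.comp (Continuous.prodMk (continuous_id (X := X)) continuous_id)
    have := hcont.comp (Continuous.prodMk (continuous_const (y := x)) (continuous_id (X := X)))
    simp only [Function.comp_def, id] at *
    fun_prop
  have := h2.tendsto x
  rwa [show k x x - 2 * k x x + k x x = 0 by ring, Real.sqrt_zero] at this

theorem continuous_kernelRKHS [TopologicalSpace X]
    (hcont : Continuous fun p : X × X => k p.1 p.2) (h : KernelRKHS k hk) :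
    Continuous fun x => h x := by
  have := continuous_feature hk hcont
  simp only [← inner_feature]
  fun_prop

theorem sq_apply_le (h : KernelRKHS k hk) (x : X) : h x ^ 2 ≤ ‖h‖ ^ 2 * k x x := by
  rw [← inner_feature, ← norm_feature_sq hk, ← mul_pow, sq_le_sq, abs_mul, abs_norm, abs_norm]
  exact abs_real_inner_le_norm _ _

end Feature

/-! ### The inclusion of `H_k` into `L²(ν)` -/

section Inclusion

variable {X : Type u} [TopologicalSpace X] [MeasurableSpace X] [OpensMeasurableSpace X]
  {k : X → X → ℝ} (hk : IsKernel k) (hcont : Continuous fun p : X × X => k p.1 p.2)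
  {ν : Measure X} (hint : Integrable (fun v => k v v) ν)

include hcont hint

theorem memLp_kernelRKHS (h : KernelRKHS k hk) : MemLp (fun v => h v) 2 ν := by
  have hm : AEStronglyMeasurable (fun v => h v) ν :=
    (continuous_kernelRKHS hk hcont h).measurable.aestronglyMeasurable
  rw [memLp_two_iff_integrable_sq hm]
  refine (hint.const_mul (‖h‖ ^ 2)).mono' (hm.pow 2) (.of_forall fun v => ?_)
  simpa using sq_apply_le hk h v

/-- The inclusion of `H_k` into `L²(ν)`. -/
theorem exists_inclusion_lp :
    ∃ J : KernelRKHS k hk →L[ℝ] Lp ℝ 2 ν, ∀ h, (J h : X → ℝ) =ᵐ[ν] fun v => h v := by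
  let J : KernelRKHS k hk →ₗ[ℝ] Lp ℝ 2 ν :=
    { toFun := fun h => (memLp_kernelRKHS hk hcont hint h).toLp
      map_add' := fun h h' => by
        rw [← MemLp.toLp_add]
        congr 1
        exact RKHS.coe_add h h'
      map_smul' := fun c h => by
        rw [RingHom.id_apply, ← MemLp.toLp_const_smul]
        congr 1
        exact RKHS.coe_smul h c }
  have hJ : ∀ h, (J h : X → ℝ) =ᵐ[ν] fun v => h v := fun h =>
    (memLp_kernelRKHS hk hcont hint h).coeFn_toLp
  -- The constant comes from integrating `h(v)² ≤ ‖h‖² k(v,v)`.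
  refine ⟨J.mkContinuous (√(∫ v, k v v ∂ν)) fun h => ?_, hJ⟩
  rw [← sq_le_sq₀ (norm_nonneg _) (by positivity), mul_pow,
    Real.sq_sqrt (integral_nonneg fun v => norm_feature_sq hk v ▸ sq_nonneg _),
    ← real_inner_self_eq_norm_sq, L2.inner_def, ← integral_mul_const]
  refine integral_mono_ae (L2.integrable_inner _ _) (hint.mul_const _) ?_
  filter_upwards [hJ h] with v hv
  simpa [hv, mul_comm, sq] using sq_apply_le hk h v

end Inclusion

/-! ### The convolution operator and its kernel -/

section TraceClass

variable {X : Type u} [MeasurableSpace X] {k : X → X → ℝ} {hk : IsKernel k} {ν : Measure X}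
  {J : KernelRKHS k hk →L[ℝ] Lp ℝ 2 ν} (hJ : ∀ h, (J h : X → ℝ) =ᵐ[ν] fun v => h v)

include hJ

theorem inner_inclusion_lp (h h' : KernelRKHS k hk) :
    ⟪J h, J h'⟫_ℝ = ∫ v, h v * h' v ∂ν := by
  rw [L2.inner_def]
  refine integral_congr_ae ?_
  filter_upwards [hJ h, hJ h'] with v h1 h2
  simp [h1, h2, mul_comm]

theorem integrable_mul_kernelRKHS (f : Lp ℝ 2 ν) (h : KernelRKHS k hk) :
    Integrable (fun v => f v * h v) ν :=
  (L2.integrable_inner (𝕜 := ℝ) (J h) f).congr <| by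
    filter_upwards [hJ h] with v h1
    simp [h1]

theorem integrable_kernelRKHS_mul (h h' : KernelRKHS k hk) :
    Integrable (fun v => h v * h' v) ν :=
  (integrable_mul_kernelRKHS hJ (J h) h').congr <| by
    filter_upwards [hJ h] with v h1
    simp [h1]

/-- Bessel's inequality for `k(·,v)` reads `∑ bᵢ(v)² ≤ k(v,v)`; integrate over `v`. -/
theorem summable_norm_inclusion_lp_sq (hint : Integrable (fun v => k v v) ν) {ι : Type*}
    (b : HilbertBasis ι ℝ (KernelRKHS k hk)) : Summable fun i => ‖J (b i)‖ ^ 2 := by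
  refine summable_of_sum_le (fun _ => by positivity) (c := ∫ v, k v v ∂ν) fun s => ?_
  simp only [← real_inner_self_eq_norm_sq, inner_inclusion_lp hJ]
  rw [← integral_finsetSum _ fun i _ => integrable_kernelRKHS_mul hJ _ _]
  refine integral_mono (integrable_finsetSum _ fun i _ => integrable_kernelRKHS_mul hJ _ _) hint
    fun v => ?_
  have := b.orthonormal.sum_inner_products_le (feature hk v) (s := s)
  simpa [inner_feature, norm_feature_sq, ← sq] using this

theorem adjoint_inclusion_lp_apply (f : Lp ℝ 2 ν) (x : X) :
    ContinuousLinearMap.adjoint J f x = ∫ v, f v * k x v ∂ν := by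
  rw [← inner_feature, ContinuousLinearMap.adjoint_inner_left, L2.inner_def]
  refine integral_congr_ae ?_
  filter_upwards [hJ (feature hk x)] with v hv
  have hs : k v x = k x v := by simpa using hk.1.apply x v
  simp [hv, feature_apply, hs, mul_comm]

theorem convKernel_eq_inner (x x' : X) :
    convKernel k ν x x' = ⟪J (feature hk x), J (feature hk x')⟫_ℝ := by
  have hs : ∀ x y, k y x = k x y := fun x y => by simpa using hk.1.apply x y
  rw [inner_inclusion_lp hJ]
  simp only [feature_apply, convKernel, hs x]

theorem isKernel_convKernel : IsKernel (convKernel k ν) := by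
  refine ⟨?_, fun c => ?_⟩
  · ext x x'
    simp [convKernel_eq_inner hJ, real_inner_comm]
  · have h : 0 ≤ ⟪c.sum fun x a => a • J (feature hk x), c.sum fun x a => a • J (feature hk x)⟫_ℝ :=
      real_inner_self_nonneg
    simp only [Finsupp.sum, sum_inner, inner_sum, inner_smul_left, inner_smul_right,
      ← convKernel_eq_inner hJ] at h
    refine h.trans_eq (Finset.sum_congr rfl fun x _ => ?_)
    rw [Finset.mul_sum]
    refine Finset.sum_congr rfl fun x' _ => ?_
    simp only [convKernel_eq_inner hJ, conj_trivial, star_trivial, Matrix.of_apply,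
      real_inner_comm (J (feature hk x))]
    ring

end TraceClass

/-- A positive operator is its own modulus. -/
theorem IsTraceClass.of_isPositive {H : Type u} [NormedAddCommGroup H] [InnerProductSpace ℝ H]
    [CompleteSpace H] {T : H →L[ℝ] H} (hT : T.IsPositive)
    (h : ∀ (ι : Type u) (b : HilbertBasis ι ℝ H), Summable fun i => ⟪T (b i), b i⟫_ℝ) :
    IsTraceClass T :=
  ⟨T, hT, by rw [hT.isSelfAdjoint.adjoint_eq], h⟩

/-- Equality of Gram matrices extends `r(·,x) ↦ J k(·,x)` to an isometry `U : H_r → G`. Then `(J† U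
f)(x) = ⟨U f, U r(·,x)⟩ = f(x)`. -/
theorem dominates_of_eq_inner {X : Type u} {k r : X → X → ℝ} {hk : IsKernel k} {hr : IsKernel r}
    {G : Type*} [NormedAddCommGroup G] [InnerProductSpace ℝ G] [CompleteSpace G]
    (J : KernelRKHS k hk →L[ℝ] G)
    (h : ∀ x x', r x x' = ⟪J (feature hk x), J (feature hk x')⟫_ℝ) : Dominates hk hr := by
  obtain ⟨U, hU, hn⟩ := exists_clm_of_inner_eq (dense_span_range_feature hr) (.id ℝ _)
    (z := fun x => J (feature hk x)) fun x x' => by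
      rw [ContinuousLinearMap.id_apply, ContinuousLinearMap.id_apply, inner_feature_feature, h,
        real_inner_comm]
  intro f
  refine ⟨ContinuousLinearMap.adjoint J (U f), fun x => ?_⟩
  let Ui : KernelRKHS r hr →ₗᵢ[ℝ] G := ⟨U.toLinearMap, hn⟩
  rw [← inner_feature, ContinuousLinearMap.adjoint_inner_left, ← hU, ← inner_feature]
  exact Ui.inner_map_map _ _

/-! ### The Gaussian prior on `H_k` and modifications -/

section Prior

variable {X : Type u} {k r : X → X → ℝ} {hk : IsKernel k}
  {G : Type u} [NormedAddCommGroup G] [InnerProductSpace ℝ G] [CompleteSpace G]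
  {J : KernelRKHS k hk →L[ℝ] G}
  (hr : ∀ x x', r x x' = ⟪J (feature hk x), J (feature hk x')⟫_ℝ)
  {ι : Type*} (b : HilbertBasis ι ℝ (KernelRKHS k hk)) (hb : Summable fun i => ‖J (b i)‖ ^ 2)

theorem covariance_eq_inner_of_ae_eq {Ω : Type*} [MeasurableSpace Ω] {P : Measure Ω}
    [IsProbabilityMeasure P] {f g : Lp ℝ 2 P} {Y Z : Ω → ℝ} (hf : f =ᵐ[P] Y) (hg : g =ᵐ[P] Z)
    (h0 : ∫ ω, Y ω ∂P = 0) : cov[Y, Z; P] = ⟪f, g⟫_ℝ := by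
  rw [covariance_eq_sub ((Lp.memLp f).ae_eq hf) ((Lp.memLp g).ae_eq hg), h0, zero_mul, sub_zero,
    L2.inner_def]
  refine integral_congr_ae ?_
  filter_upwards [hf, hg] with ω h1 h2
  simp [h1, h2, mul_comm]

include hr hb

/-- A Gaussian measure on `H_k` under which the evaluations form a version of `GP(0, r)`. -/
theorem exists_isGaussian_isGP : ∃ μ : Measure (KernelRKHS k hk),
    IsProbabilityMeasure μ ∧ IsGaussian μ ∧ IsGP r (fun x h => h x) μ := by
  obtain ⟨Ω, _, P, _, W, hW⟩ := exists_isonormal G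
  obtain ⟨F, hF⟩ := exists_lp_inner_eq (W.toContinuousLinearMap ∘L J) b (by simpa using hb)
  have hFm : AEMeasurable F P := (Lp.aestronglyMeasurable F).aemeasurable
  have hVF : ∀ h, (W (J h) : Ω → ℝ) =ᵐ[P] fun ω => ⟪F ω, h⟫_ℝ := hF
  have hlaw : ∀ h, P.map (fun ω => ⟪F ω, h⟫_ℝ) = gaussianReal 0 (‖J h‖₊ ^ 2) := fun h => by
    rw [← hW, Measure.map_congr (hVF h)]
  have hμ : IsGaussian (P.map F) := by
    -- By Riesz, `L` is the pairing with some `h`, so its law is that of `W (J h)`.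
    refine isGaussian_of_map_eq_gaussianReal fun L =>
      ⟨0, ‖J ((InnerProductSpace.toDual ℝ _).symm L)‖₊ ^ 2, ?_⟩
    rw [AEMeasurable.map_map_of_aemeasurable (by fun_prop) hFm,
      ← hlaw ((InnerProductSpace.toDual ℝ _).symm L)]
    congr 1
    ext ω
    rw [real_inner_comm, InnerProductSpace.toDual_symm_apply, Function.comp_apply]
  have hev : ∀ x, (fun h : KernelRKHS k hk => h x) = innerSL ℝ (feature hk x) := fun x => by
    ext h
    rw [innerSL_apply_apply, real_inner_comm, inner_feature]
  have hmeas : ∀ x, Measurable fun h : KernelRKHS k hk => h x := fun x => by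
    rw [hev]; fun_prop
  have hVF' : ∀ x, (W (J (feature hk x)) : Ω → ℝ) =ᵐ[P] fun ω => F ω x := fun x => by
    simpa only [inner_feature] using hVF (feature hk x)
  have h0 : ∀ x, ∫ ω, F ω x ∂P = 0 := fun x => by
    have := hlaw (feature hk x)
    simp only [inner_feature] at this
    have h : HasLaw (fun ω => F ω x) (gaussianReal 0 (‖J (feature hk x)‖₊ ^ 2)) P :=
      ⟨(hmeas x).comp_aemeasurable hFm, this⟩
    rw [h.integral_eq, integral_id_gaussianReal]
  refine ⟨P.map F, inferInstance, hμ, ⟨⟨fun I => ⟨?_⟩⟩, fun x => ?_, fun x x' => ?_⟩⟩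
  · have : (fun h : KernelRKHS k hk => I.restrict fun x => h x) =
        ContinuousLinearMap.pi fun x : I => innerSL ℝ (feature hk x) := by
      ext h x
      exact congrFun (hev x) h
    rw [this]
    infer_instance
  · rw [integral_map hFm (hmeas x).aestronglyMeasurable, h0]
  · rw [covariance_map (hmeas x).aestronglyMeasurable (hmeas x').aestronglyMeasurable hFm, hr]
    exact (covariance_eq_inner_of_ae_eq (hVF' x) (hVF' x') (h0 x)).trans (W.inner_map_map _ _)

omit [CompleteSpace G] in
/-- A version of `GP(0, r)` has a modification that is a random element of `H_k`. -/
theorem IsGP.exists_stronglyMeasurable {Ω : Type*} [MeasurableSpace Ω] {P : Measure Ω}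
    [IsProbabilityMeasure P] {Y : X → Ω → ℝ} (hY : IsGP r Y P) :
    ∃ F : Ω → KernelRKHS k hk, StronglyMeasurable F ∧ ∀ x, ∀ᵐ ω ∂P, Y x ω = F ω x := by
  have hmem : ∀ x, MemLp (Y x) 2 P := fun x => (hY.isGaussianProcess.hasGaussianLaw_eval x).memLp_two
  -- The covariance of `Y` is its Gram matrix in `L²(P)`. Since `‖V h‖ = ‖J h‖`, `V` inherits the
  -- Hilbert–Schmidt property from `J`.
  obtain ⟨V, hV, hn⟩ := exists_clm_of_inner_eq (dense_span_range_feature hk) J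
    (z := fun x => (hmem x).toLp) fun x x' => by
      rw [← hr, ← hY.cov_eq, covariance_eq_inner_of_ae_eq (hmem x).coeFn_toLp
        (hmem x').coeFn_toLp (hY.mean_eq_zero x)]
  obtain ⟨F, hF⟩ := exists_lp_inner_eq V b (by simpa only [hn] using hb)
  refine ⟨F, Lp.stronglyMeasurable F, fun x => ?_⟩
  filter_upwards [hF (feature hk x), (hmem x).coeFn_toLp] with ω h1 h2
  rw [← h2, ← hV, h1, inner_feature]

end Prior

/-- A modification of a process with continuous paths on a separable space by continuous functions
agrees with the process along almost every path. -/
theorem ae_forall_eq_of_continuous {X Ω : Type*} [TopologicalSpace X]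
    [TopologicalSpace.SeparableSpace X] [MeasurableSpace Ω] {P : Measure Ω} {Y Z : X → Ω → ℝ}
    (hY : ∀ᵐ ω ∂P, Continuous fun x => Y x ω) (hZ : ∀ᵐ ω ∂P, Continuous fun x => Z x ω)
    (h : ∀ x, ∀ᵐ ω ∂P, Y x ω = Z x ω) : ∀ᵐ ω ∂P, ∀ x, Y x ω = Z x ω := by
  obtain ⟨D, hc, hd⟩ := TopologicalSpace.exists_countable_dense X
  filter_upwards [hY, hZ, (ae_ball_iff hc).2 fun x _ => h x] with ω h1 h2 h3
  exact congrFun (Continuous.ext_on hd h1 h2 h3)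

end KernelPrior

theorem mainTheorem1 {X : Type u} [TopologicalSpace X] [MeasurableSpace X]
    [OpensMeasurableSpace X] (k : X → X → ℝ) (hk : KernelPrior.IsKernel k)
    (hcont : Continuous fun p : X × X => k p.1 p.2)
    (ν : Measure X) [IsFiniteMeasure ν] (hint : Integrable (fun v => k v v) ν) :
    -- the convolution operator `S : L²(ν) → H_k` and `L = S S†`
    (∃ S : Lp ℝ 2 ν →L[ℝ] KernelPrior.KernelRKHS k hk,
      (∀ (f : Lp ℝ 2 ν) (x : X),
        Integrable (fun v => f v * k x v) ν ∧ S f x = ∫ v, f v * k x v ∂ν) ∧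
      (∀ h : KernelPrior.KernelRKHS k hk,
        (ContinuousLinearMap.adjoint S h : X → ℝ) =ᵐ[ν] fun v => h v) ∧
      (S ∘L ContinuousLinearMap.adjoint S).IsPositive ∧
      IsSelfAdjoint (S ∘L ContinuousLinearMap.adjoint S) ∧
      KernelPrior.IsTraceClass (S ∘L ContinuousLinearMap.adjoint S) ∧
      ∀ x x', Integrable (fun v => k x v * k v x') ν ∧
        KernelPrior.convKernel k ν x x' =
          ⟪(S ∘L ContinuousLinearMap.adjoint S) (KernelPrior.feature hk x),
            KernelPrior.feature hk x'⟫_ℝ) ∧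
    -- nuclear dominance of `k` over `r`
    (∃ hr : KernelPrior.IsKernel (KernelPrior.convKernel k ν),
      KernelPrior.NuclearlyDominates hk hr) ∧
    -- `GP(0, r)` is realised by a Gaussian probability measure on `H_k`
    (∃ μ : Measure (KernelPrior.KernelRKHS k hk), IsProbabilityMeasure μ ∧ IsGaussian μ ∧
      KernelPrior.IsGP (KernelPrior.convKernel k ν)
        (fun (x : X) (h : KernelPrior.KernelRKHS k hk) => h x) μ) ∧
    -- every version of `GP(0, r)` has a modification with all sample paths in `H_k`; it has
    -- itself almost all sample paths in `H_k` if they are continuous and `X` is separable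
    (∀ (Ω : Type w) [MeasurableSpace Ω] (P : Measure Ω) [IsProbabilityMeasure P]
      (Y : X → Ω → ℝ), KernelPrior.IsGP (KernelPrior.convKernel k ν) Y P →
      (∃ F : Ω → KernelPrior.KernelRKHS k hk, StronglyMeasurable F ∧
        ∀ x, ∀ᵐ ω ∂P, Y x ω = F ω x) ∧
      (TopologicalSpace.SeparableSpace X → (∀ᵐ ω ∂P, Continuous fun x => Y x ω) →
        ∀ᵐ ω ∂P, ∃ h : KernelPrior.KernelRKHS k hk, ∀ x, Y x ω = h x)) := by
  obtain ⟨J, hJ⟩ := KernelPrior.exists_inclusion_lp hk hcont hint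
  have hr := KernelPrior.convKernel_eq_inner hJ
  have hT : ∀ h h', ⟪(ContinuousLinearMap.adjoint J ∘L J) h, h'⟫_ℝ = ⟪J h, J h'⟫_ℝ := fun h h' =>
    ContinuousLinearMap.adjoint_inner_left J h' (J h)
  have hpos : (ContinuousLinearMap.adjoint J ∘L J).IsPositive :=
    ContinuousLinearMap.isPositive_adjoint_comp_self J
  have htr : KernelPrior.IsTraceClass (ContinuousLinearMap.adjoint J ∘L J) :=
    .of_isPositive hpos fun ι b => by
      simpa only [hT, real_inner_self_eq_norm_sq] using
        KernelPrior.summable_norm_inclusion_lp_sq hJ hint b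
  have hs : ∀ x y, k y x = k x y := fun x y => by simpa using hk.1.apply x y
  obtain ⟨s, b, -⟩ := exists_hilbertBasis ℝ (KernelPrior.KernelRKHS k hk)
  have hb := KernelPrior.summable_norm_inclusion_lp_sq hJ hint b
  refine ⟨⟨ContinuousLinearMap.adjoint J, ?_⟩, ⟨KernelPrior.isKernel_convKernel hJ,
    KernelPrior.dominates_of_eq_inner J hr, ContinuousLinearMap.adjoint J ∘L J, hpos,
    hpos.isSelfAdjoint, htr, fun x x' => (hr x x').trans (hT _ _).symm⟩,
    KernelPrior.exists_isGaussian_isGP hr b hb, ?_⟩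
  · rw [ContinuousLinearMap.adjoint_adjoint]
    refine ⟨fun f x => ⟨?_, KernelPrior.adjoint_inclusion_lp_apply hJ f x⟩, hJ, hpos,
      hpos.isSelfAdjoint, htr, fun x x' => ⟨?_, (hr x x').trans (hT _ _).symm⟩⟩
    · simpa only [KernelPrior.feature_apply, hs x] using
        KernelPrior.integrable_mul_kernelRKHS hJ f (KernelPrior.feature hk x)
    · simpa only [KernelPrior.feature_apply, hs x] using
        KernelPrior.integrable_kernelRKHS_mul hJ (KernelPrior.feature hk x)
          (KernelPrior.feature hk x')
  · intro Ω _ P _ Y hY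
    obtain ⟨F, hFm, hF⟩ := hY.exists_stronglyMeasurable hr b hb
    refine ⟨⟨F, hFm, hF⟩, fun _ hc => ?_⟩
    -- Every path of `F` is continuous, since `H_k` consists of continuous functions.
    have := KernelPrior.ae_forall_eq_of_continuous hc
      (.of_forall fun ω => KernelPrior.continuous_kernelRKHS hk hcont (F ω)) hF
    filter_upwards [this] with ω hω
    exact ⟨F ω, hω⟩
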